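/- Let $d\ge 2$, let $m\ge 1$ be an integer and let $c_0>0$. For an open set $G\subset\mathbb R^d$ let $H^m_0(G)$ be the closure of $C_c^\infty(G)$ in $H^m(\mathbb R^d)$ (functions being extended by zero). The capacity of order $m$ of a set $A\subset\mathbb R^d$ is $\mathrm{cap}_m(A)=\inf\|w\|_{H^m(\mathbb R^d)}^2$ over the real-valued $w\in H^m(\mathbb R^d)$ with $w\ge 1$ a.e. in a neighborhood of $A$. A set $\Omega\subset\mathbb R^d$ is quasi-open (of order $m$) if for every $\varepsilon>0$ there is an open set $\omega$ such that $\mathrm{cap}_m(\omega)<\varepsilon$ and $\Omega\cup\omega$ is open; in this case $H^m_0(\Omega)$ denotes the intersection of the spaces $H^m_0(G)$ over all open $G\supset\Omega$. Consider the energy spaces $V(\Omega)$ and the energy densities $\tau(u)$ given by - Problem I: $V(\Omega)=H^m_0(\Omega,\mathbb R)$ and $\tau(u)=\sum_{i\in\{1,\dots,d\}^m}|\partial_{i_1}\cdots\partial_{i_m}u|^2$; - Problem II: $m=1$, $V(\Omega)=H^1_0(\Omega,\mathbb R^d)$ and $\tau(u)=|\nabla u|^2+c_0(\nabla\cdot u)^2$;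 - Problem III: $m=1$, $V(\Omega)=\{u\in H^1_0(\Omega,\mathbb R^d):\nabla\cdot u=0\}$ and $\tau(u)=|\nabla u|^2$. Let $\tau(\cdot,\cdot)$ be the bilinear form associated with $\tau$, and let $$\Lambda(\Omega)=\inf_{0\ne u\in V(\Omega)}\frac{\int_{\mathbb R^d}\tau(u)\,dx}{\int_{\mathbb R^d}|u|^2\,dx}\,,$$ with $\Lambda(\Omega)=\infty$ if $V(\Omega)=\{0\}$. In one of these problems let $\Omega\subset\mathbb R^d$ be a quasi-open volume-constrained minimizer, that is, $\Omega$ is quasi-open with $0<|\Omega|<\infty$, and $\Lambda(\Omega)\le\Lambda(\Omega')$ for all quasi-open sets $\Omega'$ with $|\Omega'|=|\Omega|$. Let $u$ be an $L^2$-normalized eigenfunction for $\Lambda(\Omega)$, extended by zero, that is, $u\in V(\Omega)$, $\int_{\mathbb R^d}|u|^2\,dx=1$ and $$\int_{\mathbb R^d}\tau(u,\varphi)\,dx=\Lambda(\Omega)\int_{\mathbb R^d}u\cdot\varphi\,dx\qquad\text{for all }\varphi\in V(\Omega)\,.$$ Then $u$ is a local quasiminimizer of the functional $$J_f(v)=\int_{\mathbb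 R^d}\tau(v)\,dx-2\int_{\mathbb R^d}f\cdot v\,dx\qquad\text{with } f=\Lambda(\Omega)\,u\,.$$ That is, $u\in V(\mathbb R^d)$ and there are constants $C,c,R>0$ such that for all $a\in\mathbb R^d$, all $r\in(0,R]$ and all $v\in V(\mathbb R^d)$ with $v-u\in V(B_r(a))$ and $\int_{B_r(a)}\tau(v-u)\,dx\le c$ one has $$J_f(v)\ge J_f(u)-C\,r^d\,.$$ -/

import Mathlib

open MeasureTheory
open scoped ENNReal ContDiff

noncomputable section

namespace ShapeOpt

/-- Euclidean space `ℝ^d`. -/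
abbrev E (d : ℕ) : Type := EuclideanSpace ℝ (Fin d)

section Sobolev

variable {d : ℕ} {F : Type} [NormedAddCommGroup F] [InnerProductSpace ℝ F]

/-- The classical partial derivative `∂_{i_1} ⋯ ∂_{i_k} φ` of a smooth function. -/
def partialDeriv {k : ℕ} (i : Fin k → Fin d) (φ : E d → ℝ) (x : E d) : ℝ :=
  iteratedFDeriv ℝ k φ x (fun j => EuclideanSpace.single (i j) (1 : ℝ))

/-- `g` is the weak derivative `∂_{i_1} ⋯ ∂_{i_k} u` on `ℝ^d`. -/
def HasWeakDeriv {k : ℕ} (i : Fin k → Fin d) (u g : E d → F) : Prop :=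
  LocallyIntegrable u ∧ LocallyIntegrable g ∧
    ∀ φ : E d → ℝ, ContDiff ℝ ∞ φ → HasCompactSupport φ →
      ∫ x, partialDeriv i φ x • u x = (-1 : ℝ) ^ k • ∫ x, φ x • g x

open Classical in
/-- The weak derivative `∂_{i_1} ⋯ ∂_{i_k} u` (a representative of it; weak derivatives are unique
up to null sets). The value is `0` if there is none. -/
def weakDeriv {k : ℕ} (i : Fin k → Fin d) (u : E d → F) : E d → F :=
  if h : ∃ g, HasWeakDeriv i u g then h.choose else 0

/-- The Sobolev space `H^m(ℝ^d, F)`. -/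
def MemH (m : ℕ) (u : E d → F) : Prop :=
  MemLp u 2 volume ∧ ∀ k ≤ m, ∀ i : Fin k → Fin d, ∃ g, HasWeakDeriv i u g ∧ MemLp g 2 volume

/-- The square of the norm of `H^m(ℝ^d, F)`:
the sum of the squared `L²` norms of all derivatives of order at most `m`. -/
def sobolevSq (m : ℕ) (u : E d → F) : ℝ≥0∞ :=
  ∑ k ∈ Finset.range (m + 1), ∑ i : Fin k → Fin d, ∫⁻ x, ‖weakDeriv i u x‖ₑ ^ 2

/-- The space `H^m_0(G, F)` for an open set `G`: the closure of `C_c^∞(G, F)` in `H^m`.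
Its elements are extended by zero to `ℝ^d`. -/
def MemH0Open (m : ℕ) (G : Set (E d)) (u : E d → F) : Prop :=
  MemH m u ∧ ∀ ε : ℝ≥0∞, 0 < ε → ∃ φ : E d → F,
    ContDiff ℝ ∞ φ ∧ HasCompactSupport φ ∧ tsupport φ ⊆ G ∧ sobolevSq m (u - φ) < ε

/-- The space `H^m_0(Ω, F)` for a quasi-open set `Ω`: the functions that belong to
`H^m_0(Ω ∪ W, F)` for all `W` such that `Ω ∪ W` is open, that is, to `H^m_0(G, F)` for all
open `G ⊇ Ω`. If `Ω` is open, this is `H^m_0(Ω, F)` as above, since `G = Ω` is allowed. For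
quasi-open `Ω` these are precisely the `u ∈ H^m` all of whose derivatives `∂^α u`, `|α| < m`,
vanish outside `Ω` up to sets of zero capacity of order `m - |α|`. -/
def MemH0 (m : ℕ) (Ω : Set (E d)) (u : E d → F) : Prop :=
  ∀ G : Set (E d), IsOpen G → Ω ⊆ G → MemH0Open m G u

/-- The Sobolev capacity of order `m` of a set: the infimum of `‖u‖²` over the
`u ∈ H^m(ℝ^d, ℝ)` that are at least `1` almost everywhere in a neighborhood of the set. -/
def capacity (m : ℕ) (A : Set (E d)) : ℝ≥0∞ :=
  ⨅ (u : E d → ℝ) (_ : MemH m u)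
    (_ : ∃ U : Set (E d), IsOpen U ∧ A ⊆ U ∧ ∀ᵐ x, x ∈ U → 1 ≤ u x), sobolevSq m u

/-- Quasi-open sets with respect to the capacity of order `m`. -/
def IsQuasiOpen (m : ℕ) (Ω : Set (E d)) : Prop :=
  ∀ ε : ℝ≥0∞, 0 < ε → ∃ W : Set (E d), IsOpen W ∧ capacity m W < ε ∧ IsOpen (Ω ∪ W)

/-- The divergence of a vector field, through weak derivatives. -/
def weakDiv (u : E d → E d) (x : E d) : ℝ :=
  ∑ i : Fin d, (weakDeriv (fun _ : Fin 1 => i) u x) i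

/-- `∇u : ∇v`, through weak derivatives; `gradForm u u = |∇u|²`. -/
def gradForm (u v : E d → E d) (x : E d) : ℝ :=
  ∑ i : Fin d, inner ℝ (weakDeriv (fun _ : Fin 1 => i) u x) (weakDeriv (fun _ : Fin 1 => i) v x)

/-- The linear functional `v ↦ ∫ f · v` given by a function `f`. -/
def l2Functional (f : E d → F) (v : E d → F) : ℝ := ∫ x, inner ℝ (f x) (v x)

end Sobolev

/-- The data of one of the shape optimization problems; the three problems follow. -/
structure ShapeProblem (d : ℕ) (F : Type) where
  /-- the order of the Sobolev space -/
  order : ℕ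
  /-- the energy space `V(Ω)`, its elements being extended by zero to `ℝ^d` -/
  V : Set (E d) → Set (E d → F)
  /-- the symmetric bilinear form `τ(u, v)` of the energy density `τ(u) = τ(u, u)` -/
  tau : (E d → F) → (E d → F) → E d → ℝ

/-- Problem I (the polyharmonic operator of order `m`). -/
def problemI (d m : ℕ) : ShapeProblem d ℝ where
  order := m
  V Ω := {u | MemH0 m Ω u}
  tau u v x := ∑ i : Fin m → Fin d, weakDeriv i u x * weakDeriv i v x

/-- Problem II (the Lamé operator with parameter `c₀`). -/
def problemII (d : ℕ) (c₀ : ℝ) : ShapeProblem d (E d) where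
  order := 1
  V Ω := {u | MemH0 1 Ω u}
  tau u v x := gradForm u v x + c₀ * (weakDiv u x * weakDiv v x)

/-- Problem III (the Stokes operator). -/
def problemIII (d : ℕ) : ShapeProblem d (E d) where
  order := 1
  V Ω := {u | MemH0 1 Ω u ∧ ∀ᵐ x, weakDiv u x = 0}
  tau u v x := gradForm u v x

namespace ShapeProblem

variable {d : ℕ} {F : Type} [NormedAddCommGroup F] [InnerProductSpace ℝ F]

/-- `Λ(Ω)`, the infimum of `∫ τ(u) / ∫ |u|²` over `0 ≠ u ∈ V(Ω)`; it is `∞` if `V(Ω) = {0}`. -/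
def Lam (P : ShapeProblem d F) (Ω : Set (E d)) : ℝ≥0∞ :=
  ⨅ (u : E d → F) (_ : u ∈ P.V Ω) (_ : ¬ u =ᵐ[volume] 0),
    (∫⁻ x, ENNReal.ofReal (P.tau u u x)) / ∫⁻ x, ‖u x‖ₑ ^ 2

/-- `Ω` is a quasi-open set of positive finite measure that minimizes `Λ` among all quasi-open
sets of the same measure. -/
def IsVolumeConstrainedMinimizer (P : ShapeProblem d F) (Ω : Set (E d)) : Prop :=
  IsQuasiOpen P.order Ω ∧ 0 < volume Ω ∧ volume Ω < ⊤ ∧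
    ∀ Ω' : Set (E d), IsQuasiOpen P.order Ω' → volume Ω' = volume Ω → P.Lam Ω ≤ P.Lam Ω'

/-- `u` is an eigenfunction on `Ω` for the eigenvalue `Λ(Ω)`, in the weak sense. -/
def IsEigenfunction (P : ShapeProblem d F) (Ω : Set (E d)) (u : E d → F) : Prop :=
  u ∈ P.V Ω ∧ ¬ u =ᵐ[volume] 0 ∧
    ∀ φ ∈ P.V Ω, ∫ x, P.tau u φ x = (P.Lam Ω).toReal * ∫ x, inner ℝ (u x) (φ x)

/-- The functional `J_f(v) = ∫ τ(v) - 2 ⟨f, v⟩`. -/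
def J (P : ShapeProblem d F) (f : (E d → F) → ℝ) (v : E d → F) : ℝ :=
  (∫ x, P.tau v v x) - 2 * f v

/-- `u` is a local quasiminimizer of `Φ` with parameters `(C, c, R)`. -/
def IsLocalQuasiminimizerWith (P : ShapeProblem d F) (Φ : (E d → F) → ℝ) (C c R : ℝ)
    (u : E d → F) : Prop :=
  u ∈ P.V Set.univ ∧
    ∀ (a : E d) (r : ℝ), 0 < r → r ≤ R →
      ∀ v ∈ P.V Set.univ, v - u ∈ P.V (Metric.ball a r) →
        ∫ x in Metric.ball a r, P.tau (v - u) (v - u) x ≤ c →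
          Φ u - C * r ^ d ≤ Φ v

/-- `u` is a local quasiminimizer of `Φ` (for some parameters). -/
def IsLocalQuasiminimizer (P : ShapeProblem d F) (Φ : (E d → F) → ℝ) (u : E d → F) : Prop :=
  ∃ C c R : ℝ, 0 < C ∧ 0 < c ∧ 0 < R ∧ P.IsLocalQuasiminimizerWith Φ C c R u

end ShapeProblem

end ShapeOpt

end

open MeasureTheory
open scoped ENNReal ContDiff

namespace ShapeOpt

/-! ### Weak derivatives and Sobolev spaces. -/

section Sobolev

variable {d : ℕ} {F : Type} [NormedAddCommGroup F] [InnerProductSpace ℝ F]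

/-! Let `w = v - u ∈ V(B_r(a))`. Then `v = u + w` lies in `V(Ω ∪ B_r(a))`, and the union is again
quasi-open. Shrinking it by a factor `c ≥ 1` with `c ^ d = |Ω ∪ B_r(a)| / |Ω|` gives a competitor of
volume `|Ω|`, so minimality yields `Λ‖v‖² ≤ c^(2m) ∫τ(v)`. Since `c ^ d ≤ 1 + O(r^d)`, this becomes
`∫τ(v) ≥ (1 - K r^d) Λ‖v‖²` (`le_integral_tau`).

Testing the eigenvalue equation with `u` itself gives `∫τ(u) = Λ`, hence `J(u) = -Λ`. Completing the
square, `J(v) - J(u) = ∫τ(v) - Λ‖v‖² + Λ‖v - u‖² ≥ -K r^d Λ‖v‖²`.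

It remains to bound `Λ‖v‖² ≤ 2Λ + 2Λ‖w‖²`. A ball of volume `|Ω|` is also a competitor; if it
contains the support of `w`, then `Λ‖w‖² ≤ ∫τ(w)`, which is bounded by assumption.

The argument sees the three problems only through the properties in `IsHomogeneous`. Most of the
file establishes these: additivity and monotonicity of the spaces, and the behaviour of derivatives,
spaces and capacity under dilations. -/

theorem contDiff_partialDeriv {k : ℕ} (i : Fin k → Fin d) {φ : E d → ℝ} (hφ : ContDiff ℝ ∞ φ) :
    ContDiff ℝ ∞ (partialDeriv i φ) := by
  have h : ContDiff ℝ ∞ (iteratedFDeriv ℝ k φ) :=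
    hφ.iteratedFDeriv_right (i := k) (m := ∞) (by norm_cast)
  exact (ContinuousMultilinearMap.apply ℝ (fun _ : Fin k => E d) ℝ
    (fun j => EuclideanSpace.single (i j) (1 : ℝ))).contDiff.comp h

theorem tsupport_partialDeriv_subset {k : ℕ} (i : Fin k → Fin d) (φ : E d → ℝ) :
    tsupport (partialDeriv i φ) ⊆ tsupport φ := by
  refine (closure_mono fun x hx => ?_).trans (tsupport_iteratedFDeriv_subset (𝕜 := ℝ) (f := φ) k)
  simp only [Function.mem_support, partialDeriv] at hx ⊢
  intro h
  simp [h] at hx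

theorem hasCompactSupport_partialDeriv {k : ℕ} (i : Fin k → Fin d) {φ : E d → ℝ}
    (hφ : HasCompactSupport φ) : HasCompactSupport (partialDeriv i φ) :=
  hφ.of_isClosed_subset (isClosed_tsupport _) (tsupport_partialDeriv_subset i φ)

theorem partialDeriv_succ {k : ℕ} (i : Fin (k + 1) → Fin d) {φ : E d → ℝ} (hφ : ContDiff ℝ ∞ φ)
    (x : E d) : partialDeriv i φ x =
      fderiv ℝ (partialDeriv (Fin.tail i) φ) x (EuclideanSpace.single (i 0) 1) := by
  have h : ContDiff ℝ ∞ (iteratedFDeriv ℝ k φ) :=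
    hφ.iteratedFDeriv_right (i := k) (m := ∞) (by norm_cast)
  rw [partialDeriv, iteratedFDeriv_succ_apply_left]
  unfold partialDeriv
  rw [fderiv_continuousMultilinear_apply_const_apply (h.differentiable (by simp) x)]
  rfl

theorem integrable_partialDeriv_smul {k : ℕ} (i : Fin k → Fin d) {φ : E d → ℝ}
    (hφ : ContDiff ℝ ∞ φ) (hc : HasCompactSupport φ) {u : E d → F} (hu : LocallyIntegrable u) :
    Integrable fun x => partialDeriv i φ x • u x :=
  hu.integrable_smul_left_of_hasCompactSupport (contDiff_partialDeriv i hφ).continuous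
    (hasCompactSupport_partialDeriv i hc)

theorem integrable_smooth_smul {φ : E d → ℝ} (hφ : ContDiff ℝ ∞ φ) (hc : HasCompactSupport φ)
    {u : E d → F} (hu : LocallyIntegrable u) : Integrable fun x => φ x • u x :=
  hu.integrable_smul_left_of_hasCompactSupport hφ.continuous hc

namespace HasWeakDeriv

variable {k : ℕ} {i : Fin k → Fin d} {u v g h : E d → F}

theorem add (hu : HasWeakDeriv i u g) (hv : HasWeakDeriv i v h) :
    HasWeakDeriv i (u + v) (g + h) := by
  refine ⟨hu.1.add hv.1, hu.2.1.add hv.2.1, fun φ hφ hc => ?_⟩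
  simp only [Pi.add_apply, smul_add]
  rw [integral_add (integrable_partialDeriv_smul i hφ hc hu.1)
      (integrable_partialDeriv_smul i hφ hc hv.1),
    integral_add (integrable_smooth_smul hφ hc hu.2.1) (integrable_smooth_smul hφ hc hv.2.1),
    hu.2.2 φ hφ hc, hv.2.2 φ hφ hc, smul_add]

theorem neg (hu : HasWeakDeriv i u g) : HasWeakDeriv i (-u) (-g) := by
  refine ⟨hu.1.neg, hu.2.1.neg, fun φ hφ hc => ?_⟩
  simp only [Pi.neg_apply, smul_neg, integral_neg, hu.2.2 φ hφ hc]

/-- The fundamental lemma of the calculus of variations. As `weakDeriv` is a chosen representative,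
every computation with it goes through this uniqueness and holds only almost everywhere. -/
theorem ae_eq [CompleteSpace F] (hg : HasWeakDeriv i u g) (hh : HasWeakDeriv i u h) :
    g =ᵐ[volume] h := by
  have H : ∀ᵐ x, (g - h) x = 0 := by
    refine ae_eq_zero_of_integral_contDiff_smul_eq_zero (hg.2.1.sub hh.2.1) fun φ hφ hc => ?_
    simp only [Pi.sub_apply, smul_sub]
    rw [integral_sub (integrable_smooth_smul hφ hc hg.2.1) (integrable_smooth_smul hφ hc hh.2.1),
      sub_eq_zero]
    have := (hg.2.2 φ hφ hc).symm.trans (hh.2.2 φ hφ hc)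
    exact smul_right_injective F (pow_ne_zero k (by norm_num : (-1 : ℝ) ≠ 0)) this
  filter_upwards [H] with x hx
  exact sub_eq_zero.1 hx

end HasWeakDeriv

theorem hasWeakDeriv_weakDeriv {k : ℕ} {i : Fin k → Fin d} {u : E d → F}
    (h : ∃ g, HasWeakDeriv i u g) : HasWeakDeriv i u (weakDeriv i u) := by
  rw [weakDeriv, dif_pos h]
  exact h.choose_spec

theorem HasWeakDeriv.weakDeriv_ae_eq [CompleteSpace F] {k : ℕ} {i : Fin k → Fin d} {u g : E d → F}
    (h : HasWeakDeriv i u g) : weakDeriv i u =ᵐ[volume] g :=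
  (hasWeakDeriv_weakDeriv ⟨g, h⟩).ae_eq h

/-- Smooth functions with compact support have weak derivatives of all orders, and these are of the
same kind. -/
theorem exists_hasWeakDeriv_of_contDiff {k : ℕ} (i : Fin k → Fin d) {φ : E d → F}
    (hφ : ContDiff ℝ ∞ φ) (hc : HasCompactSupport φ) :
    ∃ g, ContDiff ℝ ∞ g ∧ HasCompactSupport g ∧ tsupport g ⊆ tsupport φ ∧ HasWeakDeriv i φ g := by
  induction k generalizing φ with
  | zero =>
    exact ⟨φ, hφ, hc, subset_rfl, hφ.continuous.locallyIntegrable, hφ.continuous.locallyIntegrable,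
      fun ψ _ _ => by simp [partialDeriv]⟩
  | succ k ih =>
    set e : E d := EuclideanSpace.single (i 0) 1
    have hd : ContDiff ℝ ∞ fun x => fderiv ℝ φ x e :=
      (hφ.fderiv_right (m := ∞) (by norm_cast)).clm_apply contDiff_const
    have hs : tsupport (fun x => fderiv ℝ φ x e) ⊆ tsupport φ := tsupport_fderiv_apply_subset ℝ e
    have hdc : HasCompactSupport fun x => fderiv ℝ φ x e :=
      hc.of_isClosed_subset (isClosed_tsupport _) hs
    obtain ⟨g, hg, hgc, hgs, hw⟩ := ih (Fin.tail i) hd hdc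
    refine ⟨g, hg, hgc, hgs.trans hs, hφ.continuous.locallyIntegrable, hw.2.1, fun ψ hψ hψc => ?_⟩
    have hp := contDiff_partialDeriv (Fin.tail i) hψ
    have hpc := hasCompactSupport_partialDeriv (Fin.tail i) hψc
    -- One integration by parts moves the outermost derivative from the test function to `φ`. The
    -- induction hypothesis, applied to `∂_{i 0} φ`, moves the others, so partial derivatives never
    -- have to be commuted.
    have key := integral_smul_fderiv_eq_neg_fderiv_smul_of_integrable (μ := volume)
      (f := partialDeriv (Fin.tail i) ψ) (g := φ) (v := e)
      (((hφ.continuous.locallyIntegrable).integrable_smul_left_of_hasCompactSupport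
        ((hp.fderiv_right (m := ∞) (by norm_cast)).clm_apply contDiff_const).continuous
        (hpc.of_isClosed_subset (isClosed_tsupport _) (tsupport_fderiv_apply_subset ℝ e))))
      (integrable_smooth_smul hp hpc hd.continuous.locallyIntegrable)
      (integrable_smooth_smul hp hpc hφ.continuous.locallyIntegrable)
      (fun x _ => hp.differentiable (by simp) x) (fun x _ => hφ.differentiable (by simp) x)
    simp_rw [partialDeriv_succ i hψ]
    rw [← neg_eq_iff_eq_neg] at key
    rw [← key, hw.2.2 ψ hψ hψc, pow_succ, mul_neg_one, neg_smul]

namespace MemH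

variable {m : ℕ} {u v : E d → F}

theorem hasWeakDeriv (hu : MemH m u) {k : ℕ} (hk : k ≤ m) (i : Fin k → Fin d) :
    HasWeakDeriv i u (weakDeriv i u) :=
  hasWeakDeriv_weakDeriv ((hu.2 k hk i).imp fun _ h => h.1)

theorem memLp_weakDeriv [CompleteSpace F] (hu : MemH m u) {k : ℕ} (hk : k ≤ m)
    (i : Fin k → Fin d) : MemLp (weakDeriv i u) 2 := by
  obtain ⟨g, hg, hgL⟩ := hu.2 k hk i
  exact (memLp_congr_ae hg.weakDeriv_ae_eq).2 hgL

theorem add (hu : MemH m u) (hv : MemH m v) : MemH m (u + v) := by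
  refine ⟨hu.1.add hv.1, fun k hk i => ?_⟩
  obtain ⟨g, hg, hgL⟩ := hu.2 k hk i
  obtain ⟨h, hh, hhL⟩ := hv.2 k hk i
  exact ⟨g + h, hg.add hh, hgL.add hhL⟩

theorem neg (hu : MemH m u) : MemH m (-u) := by
  refine ⟨hu.1.neg, fun k hk i => ?_⟩
  obtain ⟨g, hg, hgL⟩ := hu.2 k hk i
  exact ⟨-g, hg.neg, hgL.neg⟩

theorem sub (hu : MemH m u) (hv : MemH m v) : MemH m (u - v) := by
  rw [sub_eq_add_neg]
  exact hu.add hv.neg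

theorem weakDeriv_add [CompleteSpace F] (hu : MemH m u) (hv : MemH m v) {k : ℕ} (hk : k ≤ m)
    (i : Fin k → Fin d) : weakDeriv i (u + v) =ᵐ[volume] weakDeriv i u + weakDeriv i v :=
  ((hu.hasWeakDeriv hk i).add (hv.hasWeakDeriv hk i)).weakDeriv_ae_eq

theorem weakDeriv_sub [CompleteSpace F] (hu : MemH m u) (hv : MemH m v) {k : ℕ} (hk : k ≤ m)
    (i : Fin k → Fin d) : weakDeriv i (u - v) =ᵐ[volume] weakDeriv i u - weakDeriv i v := by
  rw [sub_eq_add_neg, sub_eq_add_neg]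
  exact ((hu.hasWeakDeriv hk i).add (hv.hasWeakDeriv hk i).neg).weakDeriv_ae_eq

end MemH

theorem memH_of_contDiff (m : ℕ) {φ : E d → F} (hφ : ContDiff ℝ ∞ φ) (hc : HasCompactSupport φ) :
    MemH m φ := by
  refine ⟨hφ.continuous.memLp_of_hasCompactSupport hc, fun k _ i => ?_⟩
  obtain ⟨g, hg, hgc, -, hw⟩ := exists_hasWeakDeriv_of_contDiff i hφ hc
  exact ⟨g, hw, hg.continuous.memLp_of_hasCompactSupport hgc⟩

theorem weakDeriv_ae_eq_zero_of_contDiff [CompleteSpace F] {k : ℕ} (i : Fin k → Fin d)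
    {φ : E d → F} (hφ : ContDiff ℝ ∞ φ) (hc : HasCompactSupport φ) :
    ∀ᵐ x, x ∉ tsupport φ → weakDeriv i φ x = 0 := by
  obtain ⟨g, -, -, hs, hw⟩ := exists_hasWeakDeriv_of_contDiff i hφ hc
  filter_upwards [hw.weakDeriv_ae_eq] with x hx hxs
  rw [hx]
  exact image_eq_zero_of_notMem_tsupport fun h => hxs (hs h)

theorem enorm_add_sq_le {F : Type*} [NormedAddCommGroup F] (x y : F) :
    ‖x + y‖ₑ ^ 2 ≤ 2 * ‖x‖ₑ ^ 2 + 2 * ‖y‖ₑ ^ 2 := by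
  have h : ‖x + y‖ ^ 2 ≤ 2 * ‖x‖ ^ 2 + 2 * ‖y‖ ^ 2 := by
    have := norm_add_le x y
    nlinarith [norm_nonneg (x + y), sq_nonneg (‖x‖ - ‖y‖)]
  simp only [← ofReal_norm]
  rw [← ENNReal.ofReal_pow (norm_nonneg _), ← ENNReal.ofReal_pow (norm_nonneg _),
    ← ENNReal.ofReal_pow (norm_nonneg _), ← ENNReal.ofReal_ofNat 2,
    ← ENNReal.ofReal_mul (by norm_num), ← ENNReal.ofReal_mul (by norm_num),
    ← ENNReal.ofReal_add (by positivity) (by positivity)]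
  exact ENNReal.ofReal_le_ofReal h

/-- A substitute for the triangle inequality in `H^m`; the factor 2 is harmless for the density
arguments. -/
theorem sobolevSq_add_le [CompleteSpace F] {m : ℕ} {u v : E d → F} (hu : MemH m u)
    (hv : MemH m v) : sobolevSq m (u + v) ≤ 2 * sobolevSq m u + 2 * sobolevSq m v := by
  simp only [sobolevSq, Finset.mul_sum, ← Finset.sum_add_distrib]
  refine Finset.sum_le_sum fun k hk => Finset.sum_le_sum fun i _ => ?_
  have hkm : k ≤ m := Nat.lt_succ_iff.1 (Finset.mem_range.1 hk)
  have hm := ((hu.memLp_weakDeriv hkm i).1.enorm.pow_const 2).const_mul 2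
  rw [← lintegral_const_mul' _ _ (by simp), ← lintegral_const_mul' _ _ (by simp),
    ← lintegral_add_left' hm]
  refine lintegral_mono_ae ?_
  filter_upwards [hu.weakDeriv_add hv hkm i] with x hx
  rw [hx]
  exact enorm_add_sq_le _ _

theorem lintegral_weakDeriv_le_sobolevSq {m k : ℕ} (hk : k ≤ m) (i : Fin k → Fin d) (u : E d → F) :
    ∫⁻ x, ‖weakDeriv i u x‖ₑ ^ 2 ≤ sobolevSq m u :=
  (Finset.single_le_sum (f := fun i : Fin k → Fin d => ∫⁻ x, ‖weakDeriv i u x‖ₑ ^ 2)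
    (fun _ _ => zero_le) (Finset.mem_univ i)).trans
    (Finset.single_le_sum (f := fun k => ∑ i : Fin k → Fin d, ∫⁻ x, ‖weakDeriv i u x‖ₑ ^ 2)
      (fun _ _ => zero_le) (Finset.mem_range.2 (Nat.lt_succ_of_le hk)))

theorem memH_zero (m : ℕ) : MemH m (0 : E d → F) :=
  memH_of_contDiff m contDiff_const (.zero)

theorem sobolevSq_zero [CompleteSpace F] (m : ℕ) : sobolevSq m (0 : E d → F) = 0 := by
  refine Finset.sum_eq_zero fun k _ => Finset.sum_eq_zero fun i _ => ?_
  rw [← lintegral_zero (μ := (volume : Measure (E d)))]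
  refine lintegral_congr_ae ?_
  filter_upwards [weakDeriv_ae_eq_zero_of_contDiff (φ := (0 : E d → F)) i contDiff_const .zero]
    with x hx
  simp [hx]

/-! ### The spaces `H^m_0`. -/

theorem MemH0Open.mono {m : ℕ} {G G' : Set (E d)} {u : E d → F} (h : MemH0Open m G u)
    (hG : G ⊆ G') : MemH0Open m G' u := by
  refine ⟨h.1, fun ε hε => ?_⟩
  obtain ⟨φ, h1, h2, h3, h4⟩ := h.2 ε hε
  exact ⟨φ, h1, h2, h3.trans hG, h4⟩

theorem MemH0Open.add [CompleteSpace F] {m : ℕ} {G : Set (E d)} {u v : E d → F}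
    (hu : MemH0Open m G u) (hv : MemH0Open m G v) : MemH0Open m G (u + v) := by
  refine ⟨hu.1.add hv.1, fun ε hε => ?_⟩
  have hε' : 0 < ε / 4 := ENNReal.div_pos hε.ne' (by simp)
  obtain ⟨φ, h1, h2, h3, h4⟩ := hu.2 (ε / 4) hε'
  obtain ⟨ψ, k1, k2, k3, k4⟩ := hv.2 (ε / 4) hε'
  refine ⟨φ + ψ, h1.add k1, h2.add k2,
    (tsupport_add φ ψ).trans (Set.union_subset h3 k3), ?_⟩
  rw [add_sub_add_comm]
  refine (sobolevSq_add_le (hu.1.sub (memH_of_contDiff m h1 h2))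
    (hv.1.sub (memH_of_contDiff m k1 k2))).trans_lt ?_
  calc 2 * sobolevSq m (u - φ) + 2 * sobolevSq m (v - ψ)
      < 2 * (ε / 4) + 2 * (ε / 4) := by
        refine ENNReal.add_lt_add ?_ ?_ <;>
          exact (ENNReal.mul_lt_mul_iff_right (by simp) (by simp)).2 (by assumption)
    _ = ε := by
        rw [← add_mul, ENNReal.div_eq_inv_mul, ← mul_assoc]
        norm_num
        rw [ENNReal.mul_inv_cancel (by simp) (by simp), one_mul]

/-- All derivatives of the approximating test functions vanish outside `G`, and this passes to the
`L²` limit. Locality of weak derivatives would not suffice, since `∂G` may have positive measure. -/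
theorem MemH0Open.weakDeriv_ae_eq_zero [CompleteSpace F] {m : ℕ} {G : Set (E d)} (hG : IsOpen G)
    {u : E d → F} (hu : MemH0Open m G u) {k : ℕ} (hk : k ≤ m) (i : Fin k → Fin d) :
    ∀ᵐ x, x ∉ G → weakDeriv i u x = 0 := by
  have h0 : ∫⁻ x in Gᶜ, ‖weakDeriv i u x‖ₑ ^ 2 = 0 := by
    refine le_antisymm (le_of_forall_gt fun ε hε => ?_) zero_le
    obtain ⟨φ, h1, h2, h3, h4⟩ := hu.2 ε hε
    refine lt_of_le_of_lt ?_ h4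
    refine le_trans ?_ (lintegral_weakDeriv_le_sobolevSq hk i _)
    refine le_trans ?_ (setLIntegral_le_lintegral Gᶜ _)
    refine (setLIntegral_congr_fun_ae hG.measurableSet.compl ?_).le
    filter_upwards [hu.1.weakDeriv_sub (memH_of_contDiff m h1 h2) hk i,
      weakDeriv_ae_eq_zero_of_contDiff i h1 h2] with x hx hx' hxG
    rw [hx, Pi.sub_apply, hx' fun h => hxG (h3 h), sub_zero]
  have hm := ((hu.1.memLp_weakDeriv hk i).1.enorm.pow_const 2).restrict (s := Gᶜ)
  rw [lintegral_eq_zero_iff' hm, Filter.EventuallyEq,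
    ae_restrict_iff' hG.measurableSet.compl] at h0
  filter_upwards [h0] with x hx hxG
  simpa using hx hxG

theorem MemH0.mono {m : ℕ} {Ω Ω' : Set (E d)} {u : E d → F} (h : MemH0 m Ω u) (hΩ : Ω ⊆ Ω') :
    MemH0 m Ω' u := fun G hG hs => h G hG (hΩ.trans hs)

theorem MemH0.memH {m : ℕ} {Ω : Set (E d)} {u : E d → F} (h : MemH0 m Ω u) : MemH m u :=
  (h Set.univ isOpen_univ (Set.subset_univ _)).1

theorem MemH0.add [CompleteSpace F] {m : ℕ} {Ω Ω' : Set (E d)} {u v : E d → F}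
    (hu : MemH0 m Ω u) (hv : MemH0 m Ω' v) : MemH0 m (Ω ∪ Ω') (u + v) := fun G hG hs =>
  (hu G hG (Set.subset_union_left.trans hs)).add (hv G hG (Set.subset_union_right.trans hs))

theorem MemH0.weakDeriv_ae_eq_zero [CompleteSpace F] {m : ℕ} {G : Set (E d)} (hG : IsOpen G)
    {u : E d → F} (hu : MemH0 m G u) {k : ℕ} (hk : k ≤ m) (i : Fin k → Fin d) :
    ∀ᵐ x, x ∉ G → weakDeriv i u x = 0 :=
  (hu G hG subset_rfl).weakDeriv_ae_eq_zero hG hk i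

/-! ### Capacity and quasi-open sets. -/

theorem capacity_empty (m : ℕ) : capacity m (∅ : Set (E d)) = 0 := by
  refine le_antisymm ?_ zero_le
  rw [← sobolevSq_zero (d := d) (F := ℝ) m]
  exact iInf₂_le_of_le 0 (memH_zero m) (iInf_le _ ⟨∅, isOpen_empty, subset_rfl, by simp⟩)

theorem isQuasiOpen_of_isOpen (m : ℕ) {G : Set (E d)} (hG : IsOpen G) : IsQuasiOpen m G :=
  fun ε hε => ⟨∅, isOpen_empty, by rwa [capacity_empty], by simpa using hG⟩

/-- The same exceptional sets `W` serve for `Ω ∪ G`. -/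
theorem IsQuasiOpen.union_isOpen {m : ℕ} {Ω G : Set (E d)} (hΩ : IsQuasiOpen m Ω)
    (hG : IsOpen G) : IsQuasiOpen m (Ω ∪ G) := fun ε hε => by
  obtain ⟨W, h1, h2, h3⟩ := hΩ ε hε
  exact ⟨W, h1, h2, by rw [Set.union_right_comm]; exact h3.union hG⟩

end Sobolev

/-! ### Behaviour under dilations. -/

section Dilation

variable {d : ℕ} {F : Type} [NormedAddCommGroup F] [InnerProductSpace ℝ F]

/-- The dilation `x ↦ c • x` as a homeomorphism. -/
noncomputable def dilation (d : ℕ) {c : ℝ} (hc : c ≠ 0) : E d ≃ₜ E d := Homeomorph.smulOfNeZero c hc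

@[simp]
theorem dilation_apply {c : ℝ} (hc : c ≠ 0) (x : E d) : dilation d hc x = c • x := rfl

theorem map_dilation {c : ℝ} (hc : c ≠ 0) :
    (volume : Measure (E d)).map (dilation d hc) =
      ENNReal.ofReal |(c ^ d)⁻¹| • (volume : Measure (E d)) := by
  have := Measure.map_addHaar_smul (volume : Measure (E d)) hc
  rwa [finrank_euclideanSpace_fin] at this

theorem quasiMeasurePreserving_dilation {c : ℝ} (hc : c ≠ 0) :
    Measure.QuasiMeasurePreserving (fun x : E d => c • x) volume volume := by
  refine ⟨(dilation d hc).continuous.measurable, ?_⟩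
  have := map_dilation (d := d) hc
  refine (this.trans_le le_rfl).absolutelyContinuous.trans ?_
  exact Measure.smul_absolutelyContinuous

theorem memLp_comp_dilation {F : Type*} [NormedAddCommGroup F] {c : ℝ} (hc : c ≠ 0)
    {p : ℝ≥0∞} {u : E d → F} (hu : MemLp u p) :
    MemLp (fun x => u (c • x)) p := by
  have h : MemLp u p ((volume : Measure (E d)).map (dilation d hc)) := by
    rw [map_dilation hc]
    exact hu.smul_measure (by simp)
  exact h.comp_of_map (dilation d hc).continuous.aemeasurable

theorem locallyIntegrable_comp_dilation {F : Type*} [NormedAddCommGroup F] {c : ℝ} (hc : c ≠ 0)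
    {u : E d → F}
    (hu : LocallyIntegrable u) : LocallyIntegrable (fun x => u (c • x)) := by
  refine (locallyIntegrable_map_homeomorph (dilation d hc) (f := u)).1 ?_
  rw [map_dilation hc]
  intro x
  obtain ⟨s, hs, hint⟩ := hu x
  refine ⟨s, hs, ?_⟩
  rw [IntegrableOn, Measure.restrict_smul]
  exact hint.smul_measure (by simp)

theorem lintegral_comp_dilation {c : ℝ} (hc : c ≠ 0) (f : E d → ℝ≥0∞) :
    ∫⁻ x, f (c • x) = ENNReal.ofReal |(c ^ d)⁻¹| * ∫⁻ x, f x := by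
  have h := lintegral_map_equiv (μ := (volume : Measure (E d))) f (dilation d hc).toMeasurableEquiv
  simp only [Homeomorph.toMeasurableEquiv_coe, dilation_apply] at h
  rw [← h, map_dilation hc, lintegral_smul_measure, smul_eq_mul]

theorem integral_comp_dilation {G : Type*} [NormedAddCommGroup G] [NormedSpace ℝ G] (c : ℝ)
    (f : E d → G) : ∫ x, f (c • x) = |(c ^ d)⁻¹| • ∫ x, f x := by
  have := Measure.integral_comp_smul (volume : Measure (E d)) f c
  rwa [finrank_euclideanSpace_fin] at this

theorem contDiff_comp_dilation {G : Type*} [NormedAddCommGroup G] [NormedSpace ℝ G] (c : ℝ)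
    {φ : E d → G} (hφ : ContDiff ℝ ∞ φ) : ContDiff ℝ ∞ fun x => φ (c • x) :=
  hφ.comp (contDiff_const_smul c)

theorem partialDeriv_comp_dilation {k : ℕ} (i : Fin k → Fin d) (c : ℝ) {φ : E d → ℝ}
    (hφ : ContDiff ℝ ∞ φ) (x : E d) :
    partialDeriv i (fun x => φ (c • x)) x = c ^ k * partialDeriv i φ (c • x) := by
  unfold partialDeriv
  rw [iteratedFDeriv_comp_const_smul c (hφ.of_le (by exact_mod_cast le_top))]
  simp

/-- A change of variables transfers the dilation to the test function, which becomes `φ (c⁻¹ • x)`;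
the chain rule for smooth functions then supplies the factor `c ^ k`. -/
theorem HasWeakDeriv.comp_dilation {k : ℕ} {i : Fin k → Fin d} {u g : E d → F} {c : ℝ}
    (hc : c ≠ 0) (h : HasWeakDeriv i u g) :
    HasWeakDeriv i (fun x => u (c • x)) (fun x => c ^ k • g (c • x)) := by
  refine ⟨locallyIntegrable_comp_dilation hc h.1,
    (locallyIntegrable_comp_dilation hc h.2.1).smul (c ^ k), fun φ hφ hφc => ?_⟩
  have hψ := contDiff_comp_dilation c⁻¹ hφ
  have hψc : HasCompactSupport fun x => φ (c⁻¹ • x) :=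
    hφc.comp_homeomorph (dilation d (inv_ne_zero hc))
  have key := h.2.2 _ hψ hψc
  have h1 : ∫ x, partialDeriv i φ x • u (c • x) =
      c ^ k • |(c ^ d)⁻¹| • ∫ x, partialDeriv i (fun x => φ (c⁻¹ • x)) x • u x := by
    rw [← integral_comp_dilation, ← integral_smul]
    congr 1 with x
    rw [partialDeriv_comp_dilation i c⁻¹ hφ, smul_smul c⁻¹, inv_mul_cancel₀ hc, one_smul, smul_smul,
      ← mul_assoc, ← mul_pow, mul_inv_cancel₀ hc, one_pow, one_mul]
  have h2 : ∫ x, φ x • c ^ k • g (c • x) =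
      c ^ k • |(c ^ d)⁻¹| • ∫ x, φ (c⁻¹ • x) • g x := by
    rw [← integral_comp_dilation, ← integral_smul]
    congr 1 with x
    rw [smul_smul c⁻¹, inv_mul_cancel₀ hc, one_smul, smul_comm]
  rw [h1, h2, key, smul_comm (|(c ^ d)⁻¹|), smul_comm (c ^ k)]

theorem MemH.comp_dilation {m : ℕ} {u : E d → F} {c : ℝ} (hc : c ≠ 0) (hu : MemH m u) :
    MemH m fun x => u (c • x) := by
  refine ⟨memLp_comp_dilation hc hu.1, fun k hk i => ?_⟩
  obtain ⟨g, hg, hgL⟩ := hu.2 k hk i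
  exact ⟨_, hg.comp_dilation hc, (memLp_comp_dilation hc hgL).const_smul (c ^ k)⟩

variable [CompleteSpace F]

theorem MemH.weakDeriv_comp_dilation {m : ℕ} {u : E d → F} {c : ℝ} (hc : c ≠ 0) (hu : MemH m u)
    {k : ℕ} (hk : k ≤ m) (i : Fin k → Fin d) :
    weakDeriv i (fun x => u (c • x)) =ᵐ[volume] fun x => c ^ k • weakDeriv i u (c • x) :=
  ((hu.hasWeakDeriv hk i).comp_dilation hc).weakDeriv_ae_eq

/-- The factor by which a dilation increases the Sobolev norm at most. -/
noncomputable def dilationBound (d m : ℕ) (c : ℝ) : ℝ≥0∞ :=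
  ENNReal.ofReal ((1 + |c|) ^ (2 * m) * |(c ^ d)⁻¹|)

theorem dilationBound_pos (d m : ℕ) {c : ℝ} (hc : c ≠ 0) : 0 < dilationBound d m c :=
  ENNReal.ofReal_pos.2 (by positivity)

theorem dilationBound_ne_top (d m : ℕ) (c : ℝ) : dilationBound d m c ≠ ⊤ := ENNReal.ofReal_ne_top

/-- Derivatives of order `k` contribute `|c|^(2k)` times the Jacobian. These factors differ with
`k`, and `(1 + |c|)^(2m)` dominates all of them, whether `|c|` is small or large. -/
theorem MemH.sobolevSq_comp_dilation_le {m : ℕ} {u : E d → F} {c : ℝ} (hc : c ≠ 0)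
    (hu : MemH m u) : sobolevSq m (fun x => u (c • x)) ≤ dilationBound d m c * sobolevSq m u := by
  simp only [sobolevSq, Finset.mul_sum]
  refine Finset.sum_le_sum fun k hk => Finset.sum_le_sum fun i _ => ?_
  have hkm : k ≤ m := Nat.lt_succ_iff.1 (Finset.mem_range.1 hk)
  have h1 : ∫⁻ x, ‖weakDeriv i (fun x => u (c • x)) x‖ₑ ^ 2 =
      ∫⁻ x, ENNReal.ofReal (|c| ^ (2 * k)) * ‖weakDeriv i u (c • x)‖ₑ ^ 2 := by
    refine lintegral_congr_ae ?_
    filter_upwards [hu.weakDeriv_comp_dilation hc hkm i] with x hx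
    rw [hx, enorm_smul, mul_pow, Real.enorm_eq_ofReal_abs, ← ENNReal.ofReal_pow (abs_nonneg _),
      abs_pow, ← pow_mul, mul_comm k 2]
  rw [h1, lintegral_const_mul' _ _ (by simp),
    lintegral_comp_dilation hc fun x => ‖weakDeriv i u x‖ₑ ^ 2, ← mul_assoc,
    ← ENNReal.ofReal_mul (by positivity)]
  unfold dilationBound
  gcongr
  calc |c| ^ (2 * k) ≤ (1 + |c|) ^ (2 * k) := by gcongr; linarith
    _ ≤ (1 + |c|) ^ (2 * m) := pow_le_pow_right₀ (by linarith [abs_nonneg c]) (by omega)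

theorem MemH0Open.comp_dilation {m : ℕ} {G : Set (E d)} {u : E d → F} {c : ℝ} (hc : c ≠ 0)
    (hu : MemH0Open m G u) :
    MemH0Open m ((fun x => c • x) ⁻¹' G) fun x => u (c • x) := by
  refine ⟨hu.1.comp_dilation hc, fun ε hε => ?_⟩
  obtain ⟨φ, h1, h2, h3, h4⟩ := hu.2 (ε / dilationBound d m c)
    (ENNReal.div_pos hε.ne' (dilationBound_ne_top d m c))
  refine ⟨fun x => φ (c • x), contDiff_comp_dilation c h1,
    h2.comp_homeomorph (dilation d hc), ?_, ?_⟩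
  · have := tsupport_comp_eq_preimage φ (dilation d hc)
    exact this.trans_subset (Set.preimage_mono h3)
  · refine ((hu.1.sub (memH_of_contDiff m h1 h2)).sobolevSq_comp_dilation_le hc).trans_lt ?_
    rw [mul_comm]
    exact (ENNReal.lt_div_iff_mul_lt (.inl (dilationBound_pos d m hc).ne')
      (.inl (dilationBound_ne_top d m c))).1 h4

theorem MemH0.comp_dilation {m : ℕ} {Ω : Set (E d)} {u : E d → F} {c : ℝ} (hc : c ≠ 0)
    (hu : MemH0 m Ω u) : MemH0 m ((fun x => c • x) ⁻¹' Ω) fun x => u (c • x) := by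
  intro G hG hs
  have hG' : IsOpen ((dilation d hc).symm ⁻¹' G) := hG.preimage (dilation d hc).symm.continuous
  have hs' : Ω ⊆ (dilation d hc).symm ⁻¹' G := fun x hx => hs <| by
    change dilation d hc ((dilation d hc).symm x) ∈ Ω
    simpa using hx
  have := (hu _ hG' hs').comp_dilation hc
  convert this using 1
  ext x
  change x ∈ G ↔ (dilation d hc).symm (dilation d hc x) ∈ G
  rw [Homeomorph.symm_apply_apply]

/-- Dilating an exceptional set together with its capacity test function increases the capacity by
at most a fixed factor, so one starts from `ε` divided by this factor. -/
theorem IsQuasiOpen.preimage_dilation {m : ℕ} {Ω : Set (E d)} {c : ℝ} (hc : c ≠ 0)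
    (hΩ : IsQuasiOpen m Ω) : IsQuasiOpen m ((fun x => c • x) ⁻¹' Ω) := by
  intro ε hε
  obtain ⟨W, h1, h2, h3⟩ := hΩ (ε / dilationBound d m c)
    (ENNReal.div_pos hε.ne' (dilationBound_ne_top d m c))
  have hcont : Continuous fun x : E d => c • x := continuous_const_smul c
  refine ⟨(fun x => c • x) ⁻¹' W, h1.preimage hcont, ?_, h3.preimage hcont⟩
  simp only [capacity, iInf_lt_iff] at h2
  obtain ⟨w, hw, ⟨U, hU, hWU, hwU⟩, hlt⟩ := h2
  refine (iInf₂_le_of_le (fun x => w (c • x)) (hw.comp_dilation hc) (iInf_le _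
    ⟨(fun x => c • x) ⁻¹' U, hU.preimage hcont, Set.preimage_mono hWU,
      (quasiMeasurePreserving_dilation hc).ae hwU⟩)).trans_lt ?_
  refine (hw.sobolevSq_comp_dilation_le hc).trans_lt ?_
  rw [mul_comm]
  exact (ENNReal.lt_div_iff_mul_lt (.inl (dilationBound_pos d m hc).ne')
    (.inl (dilationBound_ne_top d m c))).1 hlt

end Dilation

/-! ### `L²` identities and volumes of balls. -/

theorem integrable_inner_of_memLp {α F : Type*} [MeasurableSpace α] {μ : Measure α}
    [NormedAddCommGroup F] [InnerProductSpace ℝ F] {f g : α → F} (hf : MemLp f 2 μ)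
    (hg : MemLp g 2 μ) : Integrable (fun x => inner ℝ (f x) (g x)) μ := by
  refine (L2.integrable_inner (𝕜 := ℝ) (hf.toLp f) (hg.toLp g)).congr ?_
  filter_upwards [hf.coeFn_toLp, hg.coeFn_toLp] with x h1 h2
  rw [h1, h2]

theorem integrable_norm_sq_of_memLp {α F : Type*} [MeasurableSpace α] {μ : Measure α}
    [NormedAddCommGroup F] [InnerProductSpace ℝ F] {f : α → F} (hf : MemLp f 2 μ) :
    Integrable (fun x => ‖f x‖ ^ 2) μ := by
  simpa only [real_inner_self_eq_norm_sq] using integrable_inner_of_memLp hf hf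

theorem integral_norm_sub_sq_of_memLp {α F : Type*} [MeasurableSpace α] {μ : Measure α}
    [NormedAddCommGroup F] [InnerProductSpace ℝ F] {f g : α → F} (hf : MemLp f 2 μ)
    (hg : MemLp g 2 μ) : ∫ x, ‖f x - g x‖ ^ 2 ∂μ =
      ∫ x, ‖f x‖ ^ 2 ∂μ - 2 * ∫ x, inner ℝ (g x) (f x) ∂μ + ∫ x, ‖g x‖ ^ 2 ∂μ := by
  have hf2 := integrable_norm_sq_of_memLp hf
  have hg2 := integrable_norm_sq_of_memLp hg
  have hi := (integrable_inner_of_memLp hg hf).const_mul 2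
  have hs := integral_add (hf2.sub hi) hg2
  simp only [Pi.sub_apply] at hs
  rw [← integral_const_mul, ← integral_sub hf2 hi, ← hs]
  congr 1 with x
  rw [norm_sub_sq_real, real_inner_comm]

theorem integral_norm_sq_le_of_memLp {α F : Type*} [MeasurableSpace α] {μ : Measure α}
    [NormedAddCommGroup F] [InnerProductSpace ℝ F] {f g : α → F} (hf : MemLp f 2 μ)
    (hg : MemLp g 2 μ) :
    ∫ x, ‖f x‖ ^ 2 ∂μ ≤ 2 * ∫ x, ‖g x‖ ^ 2 ∂μ + 2 * ∫ x, ‖f x - g x‖ ^ 2 ∂μ := by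
  have hg2 := (integrable_norm_sq_of_memLp hg).const_mul 2
  have hd2 := (integrable_norm_sq_of_memLp (hf.sub hg)).const_mul 2
  rw [← integral_const_mul, ← integral_const_mul]
  refine (integral_mono (integrable_norm_sq_of_memLp hf) (hg2.add hd2) fun x => ?_).trans
    (integral_add hg2 hd2).le
  have h := norm_add_le (g x) (f x - g x)
  rw [add_sub_cancel] at h
  change ‖f x‖ ^ 2 ≤ 2 * ‖g x‖ ^ 2 + 2 * ‖f x - g x‖ ^ 2
  nlinarith [norm_nonneg (f x), sq_nonneg (‖g x‖ - ‖f x - g x‖)]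

theorem lintegral_enorm_sq_eq_ofReal {α F : Type*} [MeasurableSpace α] {μ : Measure α}
    [NormedAddCommGroup F] [InnerProductSpace ℝ F] {f : α → F} (hf : MemLp f 2 μ) :
    ∫⁻ x, ‖f x‖ₑ ^ 2 ∂μ = ENNReal.ofReal (∫ x, ‖f x‖ ^ 2 ∂μ) := by
  rw [ofReal_integral_eq_lintegral_ofReal (integrable_norm_sq_of_memLp hf)
    (.of_forall fun _ => by positivity)]
  congr 1 with x
  rw [ENNReal.ofReal_pow (norm_nonneg _), ofReal_norm]

/-- A radius for which balls have a given volume. -/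
theorem exists_volume_ball_eq {d : ℕ} (hd : d ≠ 0) {M : ℝ≥0∞} (h0 : 0 < M) (h1 : M < ⊤) :
    ∃ ρ : ℝ, 0 < ρ ∧ ∀ a : E d, volume (Metric.ball a ρ) = M := by
  have : Nonempty (Fin d) := ⟨⟨0, Nat.pos_of_ne_zero hd⟩⟩
  have : Nontrivial (E d) := inferInstance
  set κ := volume (Metric.ball (0 : E d) 1)
  have hκ0 : 0 < κ := Metric.measure_ball_pos _ _ one_pos
  have hκ1 : κ < ⊤ := measure_ball_lt_top
  have hq0 : 0 < M / κ := ENNReal.div_pos h0.ne' hκ1.ne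
  have hq1 : M / κ ≠ ⊤ := (ENNReal.div_lt_top h1.ne hκ0.ne').ne
  have hq : 0 < (M / κ).toReal := ENNReal.toReal_pos hq0.ne' hq1
  refine ⟨(M / κ).toReal ^ ((d : ℝ)⁻¹), by positivity, fun a => ?_⟩
  rw [Measure.addHaar_ball _ _ (by positivity), finrank_euclideanSpace_fin,
    Real.rpow_inv_natCast_pow hq.le hd, ENNReal.ofReal_toReal hq1,
    ENNReal.div_mul_cancel hκ0.ne' hκ1.ne]

theorem volume_ball_eq {d : ℕ} (hd : d ≠ 0) (a : E d) {r : ℝ} (hr : 0 ≤ r) :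
    (volume (Metric.ball a r)).toReal = (volume (Metric.ball (0 : E d) 1)).toReal * r ^ d := by
  have : Nonempty (Fin d) := ⟨⟨0, Nat.pos_of_ne_zero hd⟩⟩
  rw [Measure.addHaar_ball _ _ hr, finrank_euclideanSpace_fin, ENNReal.toReal_mul,
    ENNReal.toReal_ofReal (by positivity), mul_comm]

/-! ### The comparison argument. -/

namespace ShapeProblem

variable {d : ℕ} {F : Type} [NormedAddCommGroup F] [InnerProductSpace ℝ F]

/-- The properties of the energy spaces and energy densities of a shape optimization problem on
which the comparison of `Ω` with the rescaled union `Ω ∪ B_r(a)` rests. -/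
structure IsHomogeneous (P : ShapeProblem d F) : Prop where
  mono : ∀ {Ω Ω' : Set (E d)} {u : E d → F}, u ∈ P.V Ω → Ω ⊆ Ω' → u ∈ P.V Ω'
  add : ∀ {Ω Ω' : Set (E d)} {u v : E d → F}, u ∈ P.V Ω → v ∈ P.V Ω' → u + v ∈ P.V (Ω ∪ Ω')
  memLp : ∀ {Ω : Set (E d)} {u : E d → F}, u ∈ P.V Ω → MemLp u 2
  integrable : ∀ {Ω : Set (E d)} {u : E d → F}, u ∈ P.V Ω → Integrable (P.tau u u)
  tau_nonneg : ∀ (u : E d → F) (x : E d), 0 ≤ P.tau u u x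
  tau_ae_eq_zero : ∀ {G : Set (E d)} {u : E d → F}, IsOpen G → u ∈ P.V G →
    ∀ᵐ x, x ∉ G → P.tau u u x = 0
  comp_dilation : ∀ {Ω : Set (E d)} {u : E d → F} {c : ℝ}, c ≠ 0 → u ∈ P.V Ω →
    (fun x => u (c • x)) ∈ P.V ((fun x => c • x) ⁻¹' Ω)
  tau_comp_dilation : ∀ {Ω : Set (E d)} {u : E d → F} {c : ℝ}, c ≠ 0 → u ∈ P.V Ω →
    ∀ᵐ x, P.tau (fun x => u (c • x)) (fun x => u (c • x)) x =
      c ^ (2 * P.order) * P.tau u u (c • x)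

namespace IsHomogeneous

variable {P : ShapeProblem d F}

/-- The Rayleigh quotient bound without division, so that `v = 0` is allowed. For `L = ∞` every `v`
in the space vanishes almost everywhere, and the value `0` of `toReal` does no harm. -/
theorem mul_integral_le (hP : P.IsHomogeneous) {Ω : Set (E d)} {v : E d → F}
    (hv : v ∈ P.V Ω) {L : ℝ≥0∞}
    (hL : L ≤ P.Lam Ω) : L.toReal * ∫ x, ‖v x‖ ^ 2 ≤ ∫ x, P.tau v v x := by
  have hA : 0 ≤ ∫ x, P.tau v v x := integral_nonneg (hP.tau_nonneg v)
  have hB : 0 ≤ ∫ x, ‖v x‖ ^ 2 := integral_nonneg fun x => by positivity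
  by_cases h0 : v =ᵐ[volume] 0
  · have : ∫ x, ‖v x‖ ^ 2 = 0 := by
      rw [integral_eq_zero_of_ae]
      filter_upwards [h0] with x hx
      simp [hx]
    rwa [this, mul_zero]
  have hB' : 0 < ∫ x, ‖v x‖ ^ 2 := by
    refine hB.lt_of_ne fun h => h0 ?_
    have := (integral_eq_zero_iff_of_nonneg (fun x => by positivity)
      (integrable_norm_sq_of_memLp (hP.memLp hv))).1 h.symm
    filter_upwards [this] with x hx
    simpa using hx
  have h : L ≤ ENNReal.ofReal ((∫ x, P.tau v v x) / ∫ x, ‖v x‖ ^ 2) := by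
    rw [ENNReal.ofReal_div_of_pos hB', ← lintegral_enorm_sq_eq_ofReal (hP.memLp hv),
      ofReal_integral_eq_lintegral_ofReal (hP.integrable hv) (.of_forall (hP.tau_nonneg v))]
    exact hL.trans (iInf₂_le_of_le v hv (iInf_le _ h0))
  rw [← le_div_iff₀ hB']
  exact ENNReal.toReal_le_of_le_ofReal (by positivity) h

/-- The preimage of `Ω'` under `x ↦ c • x` has the volume of `Ω`, and `v (c • x)` is a test function
on it. The Jacobian cancels, so only the factor `c^(2m)` from the energy density survives. -/
theorem mul_integral_le_rescaled (hP : P.IsHomogeneous) {Ω Ω' : Set (E d)}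
    (hΩ : P.IsVolumeConstrainedMinimizer Ω) (hΩ' : IsQuasiOpen P.order Ω') {c : ℝ} (hc : 0 < c)
    (hvol : ENNReal.ofReal (c ^ d)⁻¹ * volume Ω' = volume Ω) {v : E d → F} (hv : v ∈ P.V Ω') :
    (P.Lam Ω).toReal * ∫ x, ‖v x‖ ^ 2 ≤ c ^ (2 * P.order) * ∫ x, P.tau v v x := by
  have habs : |(c ^ d)⁻¹| = (c ^ d)⁻¹ := abs_of_pos (by positivity)
  have hvol' : volume ((fun x => c • x) ⁻¹' Ω') = volume Ω := by
    have := Measure.addHaar_preimage_smul (volume : Measure (E d)) hc.ne' Ω'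
    rwa [finrank_euclideanSpace_fin, habs, hvol] at this
  have h := hP.mul_integral_le (hP.comp_dilation hc.ne' hv)
    (hΩ.2.2.2 _ (hΩ'.preimage_dilation hc.ne') hvol')
  rw [integral_congr_ae (hP.tau_comp_dilation hc.ne' hv),
    integral_comp_dilation c fun x => ‖v x‖ ^ 2,
    integral_comp_dilation c fun x => c ^ (2 * P.order) * P.tau v v x, integral_const_mul, habs,
    smul_eq_mul, smul_eq_mul, mul_left_comm] at h
  exact le_of_mul_le_mul_left h (by positivity)

theorem le_integral_tau (hP : P.IsHomogeneous) (hd : d ≠ 0) {Ω : Set (E d)}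
    (hΩ : P.IsVolumeConstrainedMinimizer Ω) {a : E d} {r : ℝ} (hr : 0 ≤ r) {v : E d → F}
    (hv : v ∈ P.V (Ω ∪ Metric.ball a r)) :
    (1 - 2 * P.order * ((volume (Metric.ball (0 : E d) 1)).toReal / (volume Ω).toReal) * r ^ d) *
      ((P.Lam Ω).toReal * ∫ x, ‖v x‖ ^ 2) ≤ ∫ x, P.tau v v x := by
  obtain ⟨hq, h0, h1, -⟩ := id hΩ
  set Ω' := Ω ∪ Metric.ball a r
  set M := (volume Ω).toReal
  set N := (volume Ω').toReal
  have hfin : volume Ω' ≠ ⊤ :=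
    ((measure_union_le _ _).trans_lt (ENNReal.add_lt_top.2 ⟨h1, measure_ball_lt_top⟩)).ne
  have hM : 0 < M := ENNReal.toReal_pos h0.ne' h1.ne
  have hMN : M ≤ N := ENNReal.toReal_mono hfin (measure_mono Set.subset_union_left)
  have hN : 0 < N := hM.trans_le hMN
  have hNM : N ≤ M + (volume (Metric.ball (0 : E d) 1)).toReal * r ^ d := by
    rw [← volume_ball_eq hd a hr, ← ENNReal.toReal_add h1.ne measure_ball_lt_top.ne]
    exact ENNReal.toReal_mono (ENNReal.add_ne_top.2 ⟨h1.ne, measure_ball_lt_top.ne⟩)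
      (measure_union_le _ _)
  set c := (N / M) ^ ((d : ℝ)⁻¹)
  have hcd : c ^ d = N / M := Real.rpow_inv_natCast_pow (by positivity) hd
  have hc1 : 1 ≤ c := Real.one_le_rpow ((one_le_div hM).2 hMN) (by positivity)
  have hvol : ENNReal.ofReal (c ^ d)⁻¹ * volume Ω' = volume Ω := by
    rw [hcd, inv_div, ← ENNReal.ofReal_toReal hfin, ← ENNReal.ofReal_mul (by positivity),
      div_mul_cancel₀ _ hN.ne', ENNReal.ofReal_toReal h1.ne]
  have key := hP.mul_integral_le_rescaled hΩ (hq.union_isOpen Metric.isOpen_ball)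
    (zero_lt_one.trans_le hc1) hvol hv
  have hA : 0 ≤ ∫ x, P.tau v v x := integral_nonneg (hP.tau_nonneg v)
  have hB : 0 ≤ (P.Lam Ω).toReal * ∫ x, ‖v x‖ ^ 2 :=
    mul_nonneg ENNReal.toReal_nonneg (integral_nonneg fun x => by positivity)
  -- As `c ≥ 1`, one has `c ≤ c ^ d = N / M`. This crude bound replaces the exponent `2m/d` by the
  -- integer `2m`, to which Bernoulli's inequality applies.
  have hcq : c * (M / N) ≤ 1 := by
    have : c ≤ N / M := hcd ▸ le_self_pow₀ hc1 hd
    calc c * (M / N) ≤ N / M * (M / N) := by gcongr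
      _ = 1 := by field_simp
  -- Bernoulli's inequality for `(1 - (1 - M / N))^(2m)`, where `1 - M / N` is at most `|B_r| /
  -- |Ω|`.
  have hbern : 1 - 2 * P.order * ((volume (Metric.ball (0 : E d) 1)).toReal / M) * r ^ d ≤
      (M / N) ^ (2 * P.order) := by
    have hq0 : 0 ≤ M / N := by positivity
    have h2 := one_add_mul_le_pow (a := M / N - 1) (by linarith) (2 * P.order)
    have h3 : 1 - M / N ≤ (volume (Metric.ball (0 : E d) 1)).toReal / M * r ^ d := by
      calc 1 - M / N = (N - M) / N := by field_simp
        _ ≤ (N - M) / M := div_le_div_of_nonneg_left (by linarith) hM hMN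
        _ ≤ ((volume (Metric.ball (0 : E d) 1)).toReal * r ^ d) / M := by gcongr; linarith
        _ = _ := by ring
    have h4 := mul_le_mul_of_nonneg_left h3 (by positivity : (0 : ℝ) ≤ 2 * P.order)
    rw [add_sub_cancel] at h2
    push_cast at h2
    linarith
  calc _ ≤ (M / N) ^ (2 * P.order) * ((P.Lam Ω).toReal * ∫ x, ‖v x‖ ^ 2) := by gcongr
    _ ≤ (M / N) ^ (2 * P.order) * (c ^ (2 * P.order) * ∫ x, P.tau v v x) := by gcongr
    _ = (c * (M / N)) ^ (2 * P.order) * ∫ x, P.tau v v x := by rw [mul_pow]; ring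
    _ ≤ 1 * ∫ x, P.tau v v x := by gcongr; exact pow_le_one₀ (by positivity) hcq
    _ = _ := one_mul _

theorem isLocalQuasiminimizer (hP : P.IsHomogeneous) (hd : d ≠ 0) {Ω : Set (E d)} {u : E d → F}
    (hΩ : P.IsVolumeConstrainedMinimizer Ω) (hu : P.IsEigenfunction Ω u)
    (hu1 : ∫ x, ‖u x‖ ^ 2 = 1) :
    P.IsLocalQuasiminimizer (P.J (l2Functional fun x => (P.Lam Ω).toReal • u x)) u := by
  obtain ⟨ρ, hρ, hball⟩ := exists_volume_ball_eq hd hΩ.2.1 hΩ.2.2.1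
  obtain ⟨huV, -, heq⟩ := hu
  set L := (P.Lam Ω).toReal
  have hL : 0 ≤ L := ENNReal.toReal_nonneg
  have hJ : ∀ v, P.J (l2Functional fun x => L • u x) v =
      (∫ x, P.tau v v x) - 2 * (L * ∫ x, inner ℝ (u x) (v x)) := fun v => by
    simp only [J, l2Functional, inner_smul_left, integral_const_mul]
    simp
  -- The only use of the eigenvalue equation.
  have hτu : ∫ x, P.tau u u x = L := by
    rw [heq u huV]
    simp only [real_inner_self_eq_norm_sq, hu1, mul_one]
  have hJu : P.J (l2Functional fun x => L • u x) u = -L := by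
    rw [hJ, hτu]
    simp only [real_inner_self_eq_norm_sq, hu1]
    ring
  set K := 2 * P.order * ((volume (Metric.ball (0 : E d) 1)).toReal / (volume Ω).toReal)
  have hK : 0 ≤ K := by positivity
  -- The factor `2 * L + 2` bounds `Λ‖v‖²`, and the summand `1` only makes `C` positive. The radius
  -- `ρ` makes the competitor ball in `hwL` contain `B_r(a)`.
  refine ⟨K * (2 * L + 2) + 1, 1, ρ, by positivity, one_pos, hρ,
    hP.mono huV (Set.subset_univ _), fun a r hr hrρ v _ hw hle => ?_⟩
  have hτw : ∫ x, P.tau (v - u) (v - u) x ≤ 1 := by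
    rwa [setIntegral_eq_integral_of_ae_compl_eq_zero
      (hP.tau_ae_eq_zero Metric.isOpen_ball hw)] at hle
  -- Minimality against the ball `B_ρ(a)` of volume `|Ω|`, on which `v - u` is a test function.
  have hwL : L * ∫ x, ‖v x - u x‖ ^ 2 ≤ 1 :=
    (hP.mul_integral_le (hP.mono hw (Metric.ball_subset_ball hrρ))
      (hΩ.2.2.2 _ (isQuasiOpen_of_isOpen _ Metric.isOpen_ball) (hball a))).trans hτw
  have hv : v ∈ P.V (Ω ∪ Metric.ball a r) := by
    simpa using hP.add huV hw
  have hvL := hP.memLp hv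
  have huL := hP.memLp huV
  have hsub := integral_norm_sub_sq_of_memLp hvL huL
  have hvn : ∫ x, ‖v x‖ ^ 2 ≤ 2 + 2 * ∫ x, ‖v x - u x‖ ^ 2 := by
    have h := integral_norm_sq_le_of_memLp hvL huL
    rwa [hu1, mul_one] at h
  have hE := hP.le_integral_tau hd hΩ hr.le hv
  have hLv : L * ∫ x, ‖v x‖ ^ 2 ≤ 2 * L + 2 := by nlinarith
  have hrd : 0 ≤ r ^ d := by positivity
  have hn : 0 ≤ L * ∫ x, ‖v x - u x‖ ^ 2 :=
    mul_nonneg hL (integral_nonneg fun x => by positivity)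
  -- Expanded, `hn` is the completed square that absorbs the linear term `-2Λ∫u·v` of `J`.
  rw [hsub, hu1] at hn
  have hKr := mul_le_mul_of_nonneg_left hLv (mul_nonneg hK hrd)
  rw [hJu, hJ]
  change (1 - K * r ^ d) * (L * ∫ x, ‖v x‖ ^ 2) ≤ _ at hE
  nlinarith

end IsHomogeneous

end ShapeProblem

/-! ### Gradient and divergence of vector fields. -/

section VectorFields

variable {d : ℕ}

theorem gradForm_self_nonneg (u : E d → E d) (x : E d) : 0 ≤ gradForm u u x :=
  Finset.sum_nonneg fun _ _ => real_inner_self_nonneg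

theorem MemH.integrable_gradForm {u : E d → E d} (hu : MemH 1 u) : Integrable (gradForm u u) :=
  integrable_finsetSum _ fun _ _ =>
    integrable_inner_of_memLp (hu.memLp_weakDeriv le_rfl _) (hu.memLp_weakDeriv le_rfl _)

theorem MemH.memLp_weakDiv {u : E d → E d} (hu : MemH 1 u) : MemLp (weakDiv u) 2 := by
  refine memLp_finsetSum _ fun i _ => ?_
  exact (EuclideanSpace.proj i : E d →L[ℝ] ℝ).comp_memLp'
    (hu.memLp_weakDeriv le_rfl _)

theorem MemH.weakDiv_add {u v : E d → E d} (hu : MemH 1 u) (hv : MemH 1 v) :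
    weakDiv (u + v) =ᵐ[volume] weakDiv u + weakDiv v := by
  have h := ae_all_iff.2 fun i : Fin d => hu.weakDeriv_add hv le_rfl (fun _ : Fin 1 => i)
  filter_upwards [h] with x hx
  simp [weakDiv, hx, Finset.sum_add_distrib]

theorem MemH.weakDeriv_one_comp_dilation {u : E d → E d} {c : ℝ} (hc : c ≠ 0) (hu : MemH 1 u) :
    ∀ᵐ x, ∀ i : Fin d, weakDeriv (fun _ : Fin 1 => i) (fun x => u (c • x)) x =
      c • weakDeriv (fun _ : Fin 1 => i) u (c • x) := by
  refine ae_all_iff.2 fun i => ?_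
  filter_upwards [hu.weakDeriv_comp_dilation hc le_rfl (fun _ : Fin 1 => i)] with x hx
  rw [hx, pow_one]

theorem MemH.weakDiv_comp_dilation {u : E d → E d} {c : ℝ} (hc : c ≠ 0) (hu : MemH 1 u) :
    ∀ᵐ x, weakDiv (fun x => u (c • x)) x = c * weakDiv u (c • x) := by
  filter_upwards [hu.weakDeriv_one_comp_dilation hc] with x hx
  simp [weakDiv, hx, Finset.mul_sum]

theorem MemH.gradForm_comp_dilation {u : E d → E d} {c : ℝ} (hc : c ≠ 0) (hu : MemH 1 u) :
    ∀ᵐ x, gradForm (fun x => u (c • x)) (fun x => u (c • x)) x = c ^ 2 * gradForm u u (c • x) := by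
  filter_upwards [hu.weakDeriv_one_comp_dilation hc] with x hx
  simp only [gradForm, hx, Finset.mul_sum, inner_smul_left, inner_smul_right]
  refine Finset.sum_congr rfl fun i _ => ?_
  simp only [conj_trivial]
  ring

theorem MemH0.weakDeriv_one_ae_eq_zero {G : Set (E d)} (hG : IsOpen G) {u : E d → E d}
    (hu : MemH0 1 G u) :
    ∀ᵐ x, x ∉ G → ∀ i : Fin d, weakDeriv (fun _ : Fin 1 => i) u x = 0 := by
  filter_upwards [ae_all_iff.2 fun i : Fin d =>
    hu.weakDeriv_ae_eq_zero hG le_rfl (fun _ : Fin 1 => i)] with x hx hxG i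
  exact hx i hxG

end VectorFields

/-! ### The three problems satisfy the hypotheses. -/

namespace ShapeProblem

theorem isHomogeneous_problemI (d m : ℕ) : (problemI d m).IsHomogeneous where
  mono hu hs := MemH0.mono hu hs
  add hu hv := MemH0.add hu hv
  memLp hu := (MemH0.memH hu).1
  integrable hu := integrable_finsetSum _ fun i _ =>
    ((MemH0.memH hu).memLp_weakDeriv le_rfl i).integrable_mul
      ((MemH0.memH hu).memLp_weakDeriv le_rfl i)
  tau_nonneg u x := Finset.sum_nonneg fun i _ => mul_self_nonneg _
  tau_ae_eq_zero hG hu := by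
    filter_upwards [ae_all_iff.2 fun i => MemH0.weakDeriv_ae_eq_zero hG hu le_rfl i] with x hx hxG
    exact Finset.sum_eq_zero fun i _ => by rw [hx i hxG, mul_zero]
  comp_dilation hc hu := MemH0.comp_dilation hc hu
  tau_comp_dilation hc hu := by
    filter_upwards [ae_all_iff.2 fun i =>
      (MemH0.memH hu).weakDeriv_comp_dilation hc le_rfl i] with x hx
    simp only [problemI, hx, Finset.mul_sum, smul_eq_mul]
    exact Finset.sum_congr rfl fun i _ => by ring

theorem isHomogeneous_problemII (d : ℕ) {c₀ : ℝ} (hc₀ : 0 < c₀) :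
    (problemII d c₀).IsHomogeneous where
  mono hu hs := MemH0.mono hu hs
  add hu hv := MemH0.add hu hv
  memLp hu := (MemH0.memH hu).1
  integrable hu := (MemH0.memH hu).integrable_gradForm.add
    (((MemH0.memH hu).memLp_weakDiv.integrable_mul (MemH0.memH hu).memLp_weakDiv).const_mul c₀)
  tau_nonneg u x := add_nonneg (gradForm_self_nonneg u x)
    (mul_nonneg hc₀.le (mul_self_nonneg _))
  tau_ae_eq_zero hG hu := by
    filter_upwards [MemH0.weakDeriv_one_ae_eq_zero hG hu] with x hx hxG
    simp [problemII, gradForm, weakDiv, hx hxG]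
  comp_dilation hc hu := MemH0.comp_dilation hc hu
  tau_comp_dilation hc hu := by
    filter_upwards [(MemH0.memH hu).gradForm_comp_dilation hc,
      (MemH0.memH hu).weakDiv_comp_dilation hc] with x h1 h2
    simp only [problemII, h1, h2]
    ring

/-- Composition with a dilation multiplies the divergence by `c`, so the constraint survives. No
cutoff is involved, hence no correction of the divergence is needed. -/
theorem isHomogeneous_problemIII (d : ℕ) : (problemIII d).IsHomogeneous where
  mono hu hs := ⟨hu.1.mono hs, hu.2⟩
  add hu hv := by
    refine ⟨hu.1.add hv.1, ?_⟩
    filter_upwards [hu.1.memH.weakDiv_add hv.1.memH, hu.2, hv.2] with x hx h1 h2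
    rw [hx, Pi.add_apply, h1, h2, add_zero]
  memLp hu := hu.1.memH.1
  integrable hu := hu.1.memH.integrable_gradForm
  tau_nonneg u x := gradForm_self_nonneg u x
  tau_ae_eq_zero hG hu := by
    filter_upwards [hu.1.weakDeriv_one_ae_eq_zero hG] with x hx hxG
    simp [problemIII, gradForm, hx hxG]
  comp_dilation hc hu := by
    refine ⟨hu.1.comp_dilation hc, ?_⟩
    filter_upwards [hu.1.memH.weakDiv_comp_dilation hc,
      (quasiMeasurePreserving_dilation hc).ae hu.2] with x h1 h2
    rw [h1, h2, mul_zero]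
  tau_comp_dilation hc hu := hu.1.memH.gradForm_comp_dilation hc

end ShapeProblem

end ShapeOpt

theorem proposition1 (d : ℕ) (hd : 2 ≤ d) :
    (∀ (m : ℕ), 1 ≤ m → ∀ (Ω : Set (ShapeOpt.E d)) (u : ShapeOpt.E d → ℝ),
      (ShapeOpt.problemI d m).IsVolumeConstrainedMinimizer Ω →
      (ShapeOpt.problemI d m).IsEigenfunction Ω u →
      ∫ x, ‖u x‖ ^ 2 = 1 →
      (ShapeOpt.problemI d m).IsLocalQuasiminimizer
        ((ShapeOpt.problemI d m).J (ShapeOpt.l2Functional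
          (fun x => ((ShapeOpt.problemI d m).Lam Ω).toReal • u x))) u) ∧
    (∀ (c₀ : ℝ), 0 < c₀ → ∀ (Ω : Set (ShapeOpt.E d)) (u : ShapeOpt.E d → ShapeOpt.E d),
      (ShapeOpt.problemII d c₀).IsVolumeConstrainedMinimizer Ω →
      (ShapeOpt.problemII d c₀).IsEigenfunction Ω u →
      ∫ x, ‖u x‖ ^ 2 = 1 →
      (ShapeOpt.problemII d c₀).IsLocalQuasiminimizer
        ((ShapeOpt.problemII d c₀).J (ShapeOpt.l2Functional
          (fun x => ((ShapeOpt.problemII d c₀).Lam Ω).toReal • u x))) u) ∧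
    (∀ (Ω : Set (ShapeOpt.E d)) (u : ShapeOpt.E d → ShapeOpt.E d),
      (ShapeOpt.problemIII d).IsVolumeConstrainedMinimizer Ω →
      (ShapeOpt.problemIII d).IsEigenfunction Ω u →
      ∫ x, ‖u x‖ ^ 2 = 1 →
      (ShapeOpt.problemIII d).IsLocalQuasiminimizer
        ((ShapeOpt.problemIII d).J (ShapeOpt.l2Functional
          (fun x => ((ShapeOpt.problemIII d).Lam Ω).toReal • u x))) u) := by
  have hd0 : d ≠ 0 := by omega
  exact ⟨fun m _ _ _ hΩ hu hu1 =>
      (ShapeOpt.ShapeProblem.isHomogeneous_problemI d m).isLocalQuasiminimizer hd0 hΩ hu hu1,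
    fun _ hc₀ _ _ hΩ hu hu1 =>
      (ShapeOpt.ShapeProblem.isHomogeneous_problemII d hc₀).isLocalQuasiminimizer hd0 hΩ hu hu1,
    fun _ _ hΩ hu hu1 =>
      (ShapeOpt.ShapeProblem.isHomogeneous_problemIII d).isLocalQuasiminimizer hd0 hΩ hu hu1⟩
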